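/- For \(\nu>-1\) and \(x\in\mathbb R\) let \[\mathcal I_\nu(x)=\sum_{n\ge 0}\frac{\Gamma(\nu+1)}{2^{2n}\,n!\,\Gamma(\nu+n+1)}\,x^{2n}\] be the normalized modified Bessel function of the first kind (so that \(\mathcal I_\nu(x)=2^\nu\Gamma(\nu+1)x^{-\nu}I_\nu(x)\) for \(x>0\)). If \(\nu>-1\), \(r>0\) and \(|x|<r\), then \[\left(\frac{r^2-x^2}{r^2}\right)^{\kappa_\nu}\le\frac{\mathcal I_{\nu+1}(x)}{\mathcal I_\nu(x)}\le\left(\frac{r^2-x^2}{r^2}\right)^{\lambda_\nu},\qquad \kappa_\nu=\frac{r^2}{4(\nu+1)(\nu+2)},\quad \lambda_\nu=0,\] and these constants are the best possible: for given \(\nu\) and \(r\), if the left-hand inequality holds for all \(|x|<r\) with an exponent \(p\in\mathbb R\) in place of \(\kappa_\nu\), then \(p\ge\kappa_\nu\), and if the right-hand inequality holds for all \(|x|<r\) with an exponent \(q\in\mathbb R\) in place of \(\lambda_\nu\), then \(q\le\lambda_\nu\). In particular, for \(r>0\) and \(|x|<r\), \[\left(\frac{r^2-x^2}{r^2}\right)^{\kappa_{-1/2}}\le\frac{\tanh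 x}{x}\le\left(\frac{r^2-x^2}{r^2}\right)^{\lambda_{-1/2}},\] where \(\tanh x/x\) is read as \(1\) at \(x=0\), with the best possible constants (in the same sense) \(\kappa_{-1/2}=\frac{r^2}{3}\) and \(\lambda_{-1/2}=0\); for \(r=\frac{\pi}{2}\) the first of these is \(\kappa_{-1/2}=\frac{\pi^2}{12}\). -/

import Mathlib

open Real

noncomputable section

/-- The modified Bessel function of the first kind `I_ν(x)`, for `x > 0`. -/
def besselI (ν x : ℝ) : ℝ :=
  ∑' n : ℕ, (x / 2) ^ (2 * (n : ℝ) + ν) / ((n.factorial : ℝ) * Gamma (ν + n + 1))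

/-- The normalized modified Bessel function of the first kind
`𝓘_ν(x) = 2 ^ ν Γ(ν + 1) x ^ (-ν) I_ν(x)`, given for all real `x` by its power series
`∑ Γ(ν + 1) / (2 ^ (2n) n! Γ(ν + n + 1)) x ^ (2n)`. -/
def normBesselI (ν x : ℝ) : ℝ :=
  ∑' n : ℕ, Gamma (ν + 1) / (2 ^ (2 * n) * (n.factorial : ℝ) * Gamma (ν + n + 1)) * x ^ (2 * n)

/-- The power series agrees with `2 ^ ν Γ(ν + 1) x ^ (-ν) I_ν(x)` for `x > 0`. -/
theorem normBesselI_eq_besselI (ν x : ℝ) (hx : 0 < x) :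
    normBesselI ν x = 2 ^ ν * Gamma (ν + 1) * x ^ (-ν) * besselI ν x := by
  unfold normBesselI besselI
  rw [← tsum_mul_left]
  congr 1
  funext n
  have h2 : (0 : ℝ) < 2 ^ ν := rpow_pos_of_pos two_pos ν
  have hxν : (0 : ℝ) < x ^ ν := rpow_pos_of_pos hx ν
  have e : (x / 2) ^ (2 * (n : ℝ) + ν) = (x ^ (2 * n) / 2 ^ (2 * n)) * (x ^ ν / 2 ^ ν) := by
    rw [rpow_add (by positivity), div_rpow hx.le two_pos.le ν, ← div_pow, ← rpow_natCast]
    push_cast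
    rfl
  rw [e, rpow_neg hx.le]
  field_simp

/-- The series defining `𝓘_ν(x)` converges for every real `x` when `ν > -1`. -/
theorem summable_normBesselI (ν x : ℝ) (hν : -1 < ν) :
    Summable fun n : ℕ =>
      Gamma (ν + 1) / (2 ^ (2 * n) * (n.factorial : ℝ) * Gamma (ν + n + 1)) * x ^ (2 * n) := by
  have hG : ∀ n : ℕ, 0 < Gamma (ν + n + 1) := fun n =>
    Gamma_pos_of_pos (by have : (0 : ℝ) ≤ n := n.cast_nonneg
                         linarith)
  have hlim : Filter.Tendsto (fun n : ℕ => x ^ 2 / 4 * (1 / ((n : ℝ) + 1)) * (1 / (ν + 1 + n)))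
      Filter.atTop (nhds (x ^ 2 / 4 * 0 * 0)) := by
    refine (Filter.Tendsto.const_mul _ tendsto_one_div_add_atTop_nhds_zero_nat).mul ?_
    simp only [one_div]
    exact tendsto_inv_atTop_zero.comp
      (Filter.tendsto_atTop_add_const_left _ _ tendsto_natCast_atTop_atTop)
  refine summable_of_ratio_norm_eventually_le (r := 1 / 2) (by norm_num) ?_
  have hev := hlim.eventually (gt_mem_nhds (show x ^ 2 / 4 * 0 * 0 < (1 / 2 : ℝ) by norm_num))
  filter_upwards [hev] with n hn
  have hn0 : (0 : ℝ) ≤ n := n.cast_nonneg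
  have hpos : 0 < ν + 1 + n := by linarith
  have hrec : Gamma (ν + ((n + 1 : ℕ) : ℝ) + 1) = (ν + 1 + n) * Gamma (ν + n + 1) := by
    rw [show ν + ((n + 1 : ℕ) : ℝ) + 1 = (ν + 1 + n) + 1 by push_cast; ring,
      Gamma_add_one hpos.ne', show ν + 1 + (n : ℝ) = ν + n + 1 by ring]
  have hf : (((n + 1).factorial : ℕ) : ℝ) = ((n : ℝ) + 1) * n.factorial := by
    rw [Nat.factorial_succ]; push_cast; ring
  have hfp : (0 : ℝ) < n.factorial := by exact_mod_cast n.factorial_pos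
  have key : Gamma (ν + 1) / (2 ^ (2 * (n + 1)) * ((n + 1).factorial : ℝ) *
      Gamma (ν + ((n + 1 : ℕ) : ℝ) + 1)) * x ^ (2 * (n + 1)) =
      (x ^ 2 / 4 * (1 / ((n : ℝ) + 1)) * (1 / (ν + 1 + n))) *
      (Gamma (ν + 1) / (2 ^ (2 * n) * (n.factorial : ℝ) * Gamma (ν + n + 1)) * x ^ (2 * n)) := by
    have := (hG n).ne'
    rw [hrec, hf]
    field_simp
    ring
  rw [key, norm_mul]
  refine mul_le_mul_of_nonneg_right ?_ (norm_nonneg _)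
  rw [Real.norm_of_nonneg (by positivity)]
  exact hn.le

/-- The continuous function `tanh x / x`, with the value `1` at `x = 0`. -/
def tanhDiv (x : ℝ) : ℝ := if x = 0 then 1 else tanh x / x

/-- The inequalities `((r² - x²) / r²) ^ a ≤ f x ≤ ((r² - x²) / r²) ^ b` hold for all `|x| < r`,
and the constants are the best possible: no smaller exponent on the left and no larger exponent
on the right gives an inequality that is valid for all `|x| < r`. -/
def SharpExponents (r : ℝ) (f : ℝ → ℝ) (a b : ℝ) : Prop :=
  (∀ x : ℝ, |x| < r → ((r ^ 2 - x ^ 2) / r ^ 2) ^ a ≤ f x ∧ f x ≤ ((r ^ 2 - x ^ 2) / r ^ 2) ^ b) ∧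
  (∀ p : ℝ, (∀ x : ℝ, |x| < r → ((r ^ 2 - x ^ 2) / r ^ 2) ^ p ≤ f x) → a ≤ p) ∧
  (∀ q : ℝ, (∀ x : ℝ, |x| < r → f x ≤ ((r ^ 2 - x ^ 2) / r ^ 2) ^ q) → q ≤ b)

end

open Filter Topology

/-! Put `c = x² / (4(ν+1)(ν+2))`. Comparing power series in `x²` coefficient by coefficient gives
`𝓘_{ν+1} ≤ 𝓘_ν ≤ (1 + c) 𝓘_{ν+1}` (`normBesselI_add_one_le`, `normBesselI_le_mul`). The lower bound
follows from `1 + c ≤ exp c` and `1 - x²/r² ≤ exp (-x²/r²)`, since raising the latter to the power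
`κ_ν` turns its right side into `exp (-c)`. The left exponent is sharp by first-order comparison in
`t = x²` at `0`. The right one is sharp because for `q > 0` the power vanishes as `x → r`, while the
quotient stays at least `1 / 𝓘_ν(r)`. The case `ν = -1/2` is `cosh x` against `sinh x / x`. -/

/-- The coefficient of `x ^ (2 * n)` in the power series of `normBesselI ν x`. -/
noncomputable def besselCoeff (ν : ℝ) (n : ℕ) : ℝ :=
  Gamma (ν + 1) / (2 ^ (2 * n) * (n.factorial : ℝ) * Gamma (ν + n + 1))

theorem hasSum_normBesselI {ν : ℝ} (hν : -1 < ν) (x : ℝ) :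
    HasSum (fun n : ℕ => besselCoeff ν n * (x ^ 2) ^ n) (normBesselI ν x) := by
  have h := (summable_normBesselI ν x hν).hasSum
  simp only [pow_mul x] at h
  simpa only [normBesselI, besselCoeff, pow_mul x] using h

theorem besselCoeff_zero {ν : ℝ} (hν : -1 < ν) : besselCoeff ν 0 = 1 := by
  have : Gamma (ν + 1) ≠ 0 := (Gamma_pos_of_pos (by linarith)).ne'
  simp [besselCoeff, this]

theorem besselCoeff_succ {ν : ℝ} (hν : -1 < ν) (n : ℕ) :
    besselCoeff ν (n + 1) = besselCoeff ν n / (4 * (n + 1) * (ν + 1 + n)) := by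
  have hn : (0 : ℝ) ≤ n := n.cast_nonneg
  have hpos : 0 < ν + 1 + n := by linarith
  have hrec : Gamma (ν + ((n + 1 : ℕ) : ℝ) + 1) = (ν + 1 + n) * Gamma (ν + n + 1) := by
    rw [show ν + ((n + 1 : ℕ) : ℝ) + 1 = (ν + 1 + n) + 1 by push_cast; ring,
      Gamma_add_one hpos.ne', show ν + 1 + (n : ℝ) = ν + n + 1 by ring]
  unfold besselCoeff
  rw [hrec, Nat.factorial_succ]
  push_cast
  rw [div_div]
  congr 1
  ring

theorem besselCoeff_one {ν : ℝ} (hν : -1 < ν) : besselCoeff ν 1 = 1 / (4 * (ν + 1)) := by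
  simpa [besselCoeff_zero hν] using besselCoeff_succ hν 0

theorem besselCoeff_pos {ν : ℝ} (hν : -1 < ν) (n : ℕ) : 0 < besselCoeff ν n := by
  have hn : (0 : ℝ) ≤ n := n.cast_nonneg
  have h1 : 0 < Gamma (ν + 1) := Gamma_pos_of_pos (by linarith)
  have h2 : 0 < Gamma (ν + n + 1) := Gamma_pos_of_pos (by linarith)
  have hf : (0 : ℝ) < n.factorial := by exact_mod_cast n.factorial_pos
  unfold besselCoeff
  positivity

theorem besselCoeff_eq_mul_besselCoeff_add_one {ν : ℝ} (hν : -1 < ν) (n : ℕ) :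
    besselCoeff ν n = (ν + 1 + n) / (ν + 1) * besselCoeff (ν + 1) n := by
  have hν1 : 0 < ν + 1 := by linarith
  induction n with
  | zero => simp [besselCoeff_zero hν, besselCoeff_zero (show -1 < ν + 1 by linarith), hν1.ne']
  | succ n ih =>
    have hn : (0 : ℝ) ≤ n := n.cast_nonneg
    have h1 : ν + 1 + n ≠ 0 := by positivity
    have h2 : ν + 1 + 1 + n ≠ 0 := by positivity
    have h3 : (n : ℝ) + 1 ≠ 0 := by positivity
    rw [besselCoeff_succ hν, besselCoeff_succ (show -1 < ν + 1 by linarith), ih]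
    push_cast
    field_simp
    ring

/-! ### Bounds on the series -/

theorem one_add_le_normBesselI {ν : ℝ} (hν : -1 < ν) (x : ℝ) :
    1 + x ^ 2 / (4 * (ν + 1)) ≤ normBesselI ν x := by
  have h := (hasSum_normBesselI hν x).summable.sum_le_tsum (Finset.range 2)
    (fun n _ => mul_nonneg (besselCoeff_pos hν n).le (by positivity))
  rw [(hasSum_normBesselI hν x).tsum_eq] at h
  refine le_trans (le_of_eq ?_) h
  rw [Finset.sum_range_succ, Finset.sum_range_one, besselCoeff_one hν, besselCoeff_zero hν]
  ring

theorem one_le_normBesselI {ν : ℝ} (hν : -1 < ν) (x : ℝ) : 1 ≤ normBesselI ν x := by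
  have h1 : 0 < ν + 1 := by linarith
  have h2 : 0 ≤ x ^ 2 / (4 * (ν + 1)) := by positivity
  linarith [one_add_le_normBesselI hν x]

theorem normBesselI_add_one_le {ν : ℝ} (hν : -1 < ν) (x : ℝ) :
    normBesselI (ν + 1) x ≤ normBesselI ν x := by
  have hν1 : 0 < ν + 1 := by linarith
  refine hasSum_le (fun n => ?_) (hasSum_normBesselI (show -1 < ν + 1 by linarith) x)
    (hasSum_normBesselI hν x)
  have hb := (besselCoeff_pos (show -1 < ν + 1 by linarith) n).le
  rw [besselCoeff_eq_mul_besselCoeff_add_one hν]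
  refine mul_le_mul_of_nonneg_right (le_mul_of_one_le_left hb ?_) (by positivity)
  rw [one_le_div hν1]
  linarith [(n.cast_nonneg : (0 : ℝ) ≤ n)]

theorem normBesselI_mono_abs {ν : ℝ} (hν : -1 < ν) {x y : ℝ} (h : |x| ≤ |y|) :
    normBesselI ν x ≤ normBesselI ν y :=
  hasSum_le (fun n => mul_le_mul_of_nonneg_left
    (pow_le_pow_left₀ (sq_nonneg x) (sq_le_sq.2 h) n) (besselCoeff_pos hν n).le)
    (hasSum_normBesselI hν x) (hasSum_normBesselI hν y)

/-- The right side minus the left is a nonnegative multiple of `n`. Equality at `n = 0` is what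
fixes the constant `1 / (4(ν+1)(ν+2))`. -/
theorem besselCoeff_succ_le {ν : ℝ} (hν : -1 < ν) (n : ℕ) :
    besselCoeff ν (n + 1) ≤
      besselCoeff (ν + 1) (n + 1) + 1 / (4 * (ν + 1) * (ν + 2)) * besselCoeff (ν + 1) n := by
  have hν1 : 0 < ν + 1 := by linarith
  have hν2 : 0 < ν + 2 := by linarith
  have hn : (0 : ℝ) ≤ n := n.cast_nonneg
  have h2 : 0 < ν + 1 + 1 + n := by linarith
  have hb := besselCoeff_pos (show -1 < ν + 1 by linarith) n
  rw [besselCoeff_eq_mul_besselCoeff_add_one hν, besselCoeff_succ (show -1 < ν + 1 by linarith)]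
  push_cast
  rw [← sub_nonneg]
  have : besselCoeff (ν + 1) n / (4 * (n + 1) * (ν + 1 + 1 + n)) +
      1 / (4 * (ν + 1) * (ν + 2)) * besselCoeff (ν + 1) n -
      (ν + 1 + (n + 1)) / (ν + 1) *
        (besselCoeff (ν + 1) n / (4 * (n + 1) * (ν + 1 + 1 + n))) =
      besselCoeff (ν + 1) n * n / (4 * (ν + 1) * (ν + 2) * (ν + 1 + 1 + n)) := by
    field_simp
    ring
  rw [this]
  positivity

theorem normBesselI_le_mul {ν : ℝ} (hν : -1 < ν) (x : ℝ) :
    normBesselI ν x ≤ (1 + x ^ 2 / (4 * (ν + 1) * (ν + 2))) * normBesselI (ν + 1) x := by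
  have hν' : -1 < ν + 1 := by linarith
  -- The constant terms, both `1`, are removed so that the factor `x²` matches the index shift.
  have hA := (hasSum_nat_add_iff' 1).2 (hasSum_normBesselI hν x)
  have hB := hasSum_normBesselI hν' x
  have hB' := (hasSum_nat_add_iff' 1).2 hB
  have key := hasSum_le (fun n => ?_) hA
    (hB'.add (hB.mul_left (x ^ 2 / (4 * (ν + 1) * (ν + 2)))))
  · simp only [Finset.sum_range_one, besselCoeff_zero hν, besselCoeff_zero hν', pow_zero] at key
    linarith
  · have := mul_le_mul_of_nonneg_right (besselCoeff_succ_le hν n)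
      (show 0 ≤ (x ^ 2) ^ (n + 1) by positivity)
    refine this.trans (le_of_eq ?_)
    ring

/-- A polynomial majorant in `x²` lets sharpness at `0` be tested without differentiating the
series; `K` is the tail evaluated at `r`. -/
theorem exists_normBesselI_le_quadratic {ν : ℝ} (hν : -1 < ν) (r : ℝ) :
    ∃ K : ℝ, ∀ x : ℝ, |x| ≤ |r| →
      normBesselI ν x ≤ 1 + x ^ 2 / (4 * (ν + 1)) + K * (x ^ 2) ^ 2 := by
  have hS : Summable fun n : ℕ => besselCoeff ν (n + 2) * (r ^ 2) ^ n := by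
    -- The shifted series is obtained by dividing by `(r²)²`.
    by_cases hr : r = 0
    · refine summable_of_ne_finset_zero (s := {0}) fun n hn => ?_
      simp at hn
      simp [hr, hn]
    · have h := ((summable_nat_add_iff 2).2 (hasSum_normBesselI hν r).summable).mul_left
        (((r ^ 2) ^ 2)⁻¹)
      refine h.congr fun n => ?_
      field_simp
      ring
  refine ⟨∑' n : ℕ, besselCoeff ν (n + 2) * (r ^ 2) ^ n, fun x hx => ?_⟩
  have hA := (hasSum_nat_add_iff' 2).2 (hasSum_normBesselI hν x)
  have key := hasSum_le (fun n => ?_) hA (hS.hasSum.mul_right ((x ^ 2) ^ 2))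
  · rw [Finset.sum_range_succ, Finset.sum_range_one, besselCoeff_one hν, besselCoeff_zero hν,
      pow_zero, pow_one, one_div_mul_eq_div] at key
    linarith
  · have h1 : (x ^ 2) ^ n ≤ (r ^ 2) ^ n := pow_le_pow_left₀ (sq_nonneg x) (sq_le_sq.2 hx) n
    have h2 := mul_le_mul_of_nonneg_right
      (mul_le_mul_of_nonneg_left h1 (besselCoeff_pos hν (n + 2)).le) (sq_nonneg (x ^ 2))
    refine (le_of_eq ?_).trans h2
    ring

/-! ### The inequalities and their sharpness -/

theorem HasDerivAt.nonneg_of_eventually_nonneg {g : ℝ → ℝ} {d a : ℝ} (hg : HasDerivAt g d a)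
    (h0 : g a = 0) (h : ∀ᶠ t in 𝓝[>] a, 0 ≤ g t) : 0 ≤ d := by
  have ht : Tendsto (slope g a) (𝓝[>] a) (𝓝 d) :=
    (hasDerivAt_iff_tendsto_slope.1 hg).mono_left (nhdsWithin_mono _ fun t ht => ne_of_gt ht)
  refine ge_of_tendsto ht ?_
  filter_upwards [h, self_mem_nhdsWithin] with t h1 h2
  rw [slope_def_field, h0, sub_zero]
  exact div_nonneg h1 (sub_nonneg.2 (le_of_lt h2))

theorem sq_sub_sq_div_sq_pos {r x : ℝ} (hx : |x| < r) : 0 < (r ^ 2 - x ^ 2) / r ^ 2 := by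
  have hr : 0 < r := (abs_nonneg x).trans_lt hx
  have : x ^ 2 < r ^ 2 := sq_lt_sq.2 (by rwa [abs_of_pos hr])
  exact div_pos (by linarith) (by positivity)

theorem rpow_le_normBesselI_div {ν r x : ℝ} (hν : -1 < ν) (hx : |x| < r) :
    ((r ^ 2 - x ^ 2) / r ^ 2) ^ (r ^ 2 / (4 * (ν + 1) * (ν + 2))) ≤
      normBesselI (ν + 1) x / normBesselI ν x := by
  have hr : 0 < r := (abs_nonneg x).trans_lt hx
  have hν1 : 0 < ν + 1 := by linarith
  have hν2 : 0 < ν + 2 := by linarith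
  have hA : 0 < normBesselI ν x := zero_lt_one.trans_le (one_le_normBesselI hν x)
  have hB : 0 < normBesselI (ν + 1) x :=
    zero_lt_one.trans_le (one_le_normBesselI (by linarith) x)
  set c := x ^ 2 / (4 * (ν + 1) * (ν + 2)) with hc
  have h1 : (r ^ 2 - x ^ 2) / r ^ 2 ≤ exp (-(x ^ 2 / r ^ 2)) := by
    have := add_one_le_exp (-(x ^ 2 / r ^ 2))
    have e : (r ^ 2 - x ^ 2) / r ^ 2 = -(x ^ 2 / r ^ 2) + 1 := by field_simp; ring
    rwa [e]
  have h2 := rpow_le_rpow (sq_sub_sq_div_sq_pos hx).le h1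
    (show 0 ≤ r ^ 2 / (4 * (ν + 1) * (ν + 2)) by positivity)
  rw [← exp_mul, show -(x ^ 2 / r ^ 2) * (r ^ 2 / (4 * (ν + 1) * (ν + 2))) = -c by
    rw [hc]; field_simp] at h2
  refine h2.trans ?_
  rw [le_div_iff₀ hA, exp_neg, inv_mul_le_iff₀ (exp_pos c)]
  refine (normBesselI_le_mul hν x).trans (mul_le_mul_of_nonneg_right ?_ hB.le)
  linarith [add_one_le_exp c]

theorem le_of_rpow_le_normBesselI_div {ν r p : ℝ} (hν : -1 < ν) (hr : 0 < r)
    (hp : ∀ x : ℝ, |x| < r →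
      ((r ^ 2 - x ^ 2) / r ^ 2) ^ p ≤ normBesselI (ν + 1) x / normBesselI ν x) :
    r ^ 2 / (4 * (ν + 1) * (ν + 2)) ≤ p := by
  have hν1 : 0 < ν + 1 := by linarith
  have hν2 : 0 < ν + 2 := by linarith
  obtain ⟨K, hK⟩ := exists_normBesselI_le_quadratic (show -1 < ν + 1 by linarith) r
  -- With `t = x²`: the majorant of `𝓘_{ν+1}` minus the power times the minorant of `𝓘_ν`. The
  -- assumed inequality forces `g ≥ 0` to the right of `0`.
  let g : ℝ → ℝ := fun t => 1 + t / (4 * (ν + 1 + 1)) + K * t ^ 2 -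
    ((r ^ 2 - t) / r ^ 2) ^ p * (1 + t / (4 * (ν + 1)))
  have hg : HasDerivAt g (1 / (4 * (ν + 1 + 1)) + p / r ^ 2 - 1 / (4 * (ν + 1))) 0 := by
    have d0 := hasDerivAt_id (0 : ℝ)
    have d1 := ((d0.div_const (4 * (ν + 1 + 1))).const_add 1).add ((d0.pow 2).const_mul K)
    have d2 := ((d0.const_sub (r ^ 2)).div_const (r ^ 2)).rpow_const (p := p)
      (Or.inl (by simp [hr.ne']))
    have d3 := d1.sub (d2.mul ((d0.div_const (4 * (ν + 1))).const_add 1))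
    refine d3.congr_deriv ?_
    have hr2 : r ^ 2 / r ^ 2 = 1 := div_self (by positivity)
    simp [hr2]
    ring
  have hg0 : g 0 = 0 := by simp [g, hr.ne']
  have hpos : ∀ᶠ t in 𝓝[>] (0 : ℝ), 0 ≤ g t := by
    filter_upwards [Ioo_mem_nhdsGT (show (0 : ℝ) < r ^ 2 by positivity)] with t ht
    obtain ⟨ht0, ht1⟩ := ht
    have hx : |√t| < r := by
      rw [abs_of_nonneg (sqrt_nonneg t)]
      exact (sqrt_lt' hr).2 ht1
    have e : √t ^ 2 = t := sq_sqrt ht0.le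
    have hA := one_add_le_normBesselI hν (√t)
    have hB := hK (√t) (hx.le.trans (le_abs_self r))
    have h := hp _ hx
    have hw := rpow_nonneg (sq_sub_sq_div_sq_pos hx).le p
    rw [le_div_iff₀ (zero_lt_one.trans_le (one_le_normBesselI hν _))] at h
    have h' := mul_le_mul_of_nonneg_left hA hw
    rw [e] at h h' hB
    simp only [g]
    linarith
  have hd := hg.nonneg_of_eventually_nonneg hg0 hpos
  -- Scaled by `r²`, the derivative of `g` at `0` is exactly `p - κ_ν`.
  have e : r ^ 2 * (1 / (4 * (ν + 1 + 1)) + p / r ^ 2 - 1 / (4 * (ν + 1))) =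
      p - r ^ 2 / (4 * (ν + 1) * (ν + 2)) := by
    rw [show ν + 1 + 1 = ν + 2 by ring]
    field_simp
    ring
  have := mul_nonneg (sq_nonneg r) hd
  linarith

theorem nonpos_of_normBesselI_div_le_rpow {ν r q : ℝ} (hν : -1 < ν) (hr : 0 < r)
    (hq : ∀ x : ℝ, |x| < r →
      normBesselI (ν + 1) x / normBesselI ν x ≤ ((r ^ 2 - x ^ 2) / r ^ 2) ^ q) :
    q ≤ 0 := by
  by_contra! hq0
  have hA : 0 < normBesselI ν r := zero_lt_one.trans_le (one_le_normBesselI hν r)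
  have hc : ContinuousAt (fun x : ℝ => ((r ^ 2 - x ^ 2) / r ^ 2) ^ q) r :=
    -- The base is `0` at `x = r`, so continuity relies on `q` being nonnegative.
    ContinuousAt.rpow_const (by fun_prop) (Or.inr hq0.le)
  have ht : Tendsto (fun x : ℝ => ((r ^ 2 - x ^ 2) / r ^ 2) ^ q) (𝓝[<] r) (𝓝 0) := by
    have := hc.tendsto.mono_left (nhdsWithin_le_nhds (s := Set.Iio r))
    simpa [zero_rpow hq0.ne'] using this
  have hle : 1 / normBesselI ν r ≤ 0 := by
    refine ge_of_tendsto ht ?_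
    filter_upwards [Ioo_mem_nhdsLT hr] with x hx
    have hxr : |x| < r := by rw [abs_of_pos hx.1]; exact hx.2
    refine le_trans ?_ (hq x hxr)
    have hB : 1 ≤ normBesselI (ν + 1) x := one_le_normBesselI (by linarith) x
    exact div_le_div₀ (by linarith) hB (zero_lt_one.trans_le (one_le_normBesselI hν x))
      (normBesselI_mono_abs hν (hxr.le.trans (le_abs_self r)))
  exact absurd hle (not_le.2 (by positivity))

theorem sharpExponents_normBesselI_div {ν r : ℝ} (hν : -1 < ν) (hr : 0 < r) :
    SharpExponents r (fun x => normBesselI (ν + 1) x / normBesselI ν x)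
      (r ^ 2 / (4 * (ν + 1) * (ν + 2))) 0 := by
  refine ⟨fun x hx => ⟨rpow_le_normBesselI_div hν hx, ?_⟩,
    fun p hp => le_of_rpow_le_normBesselI_div hν hr hp,
    fun q hq => nonpos_of_normBesselI_div_le_rpow hν hr hq⟩
  rw [rpow_zero]
  exact div_le_one_of_le₀ (normBesselI_add_one_le hν x)
    (zero_le_one.trans (one_le_normBesselI hν x))

/-! ### The hyperbolic case `ν = -1/2` -/

theorem besselCoeff_neg_half (n : ℕ) : besselCoeff (-1 / 2) n = 1 / ((2 * n).factorial : ℝ) := by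
  induction n with
  | zero => rw [besselCoeff_zero (by norm_num)]; simp
  | succ n ih =>
    rw [besselCoeff_succ (by norm_num), ih, show 2 * (n + 1) = 2 * n + 1 + 1 by ring,
      Nat.factorial_succ, Nat.factorial_succ, div_div]
    congr 1
    push_cast
    ring

theorem besselCoeff_half (n : ℕ) :
    besselCoeff (-1 / 2 + 1) n = 1 / ((2 * n + 1).factorial : ℝ) := by
  have h := besselCoeff_eq_mul_besselCoeff_add_one (show -1 < (-1 / 2 : ℝ) by norm_num) n
  rw [besselCoeff_neg_half] at h
  have hf : ((2 * n).factorial : ℝ) ≠ 0 := by exact_mod_cast (2 * n).factorial_ne_zero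
  have h2 : 2 * (n : ℝ) + 1 ≠ 0 := by positivity
  have e : (-1 / 2 + 1 + (n : ℝ)) / (-1 / 2 + 1) = 2 * n + 1 := by ring
  rw [e] at h
  rw [Nat.factorial_succ]
  push_cast
  rw [eq_div_iff (mul_ne_zero h2 hf), mul_comm (2 * (n : ℝ) + 1), mul_left_comm,
    mul_comm (besselCoeff _ _), ← h]
  field_simp

theorem normBesselI_neg_half (x : ℝ) : normBesselI (-1 / 2) x = cosh x := by
  have h := hasSum_normBesselI (show -1 < (-1 / 2 : ℝ) by norm_num) x
  rw [← h.tsum_eq, Real.cosh_eq_tsum]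
  refine tsum_congr fun n => ?_
  rw [besselCoeff_neg_half, pow_mul]
  ring

theorem mul_normBesselI_half (x : ℝ) : x * normBesselI (-1 / 2 + 1) x = sinh x := by
  have h := hasSum_normBesselI (show -1 < (-1 / 2 + 1 : ℝ) by norm_num) x
  rw [← (h.mul_left x).tsum_eq, Real.sinh_eq_tsum]
  refine tsum_congr fun n => ?_
  rw [besselCoeff_half, ← pow_mul]
  ring

theorem normBesselI_zero {ν : ℝ} (hν : -1 < ν) : normBesselI ν 0 = 1 := by
  refine (hasSum_normBesselI hν 0).unique ?_
  have h := hasSum_single (f := fun n : ℕ => besselCoeff ν n * ((0 : ℝ) ^ 2) ^ n) 0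
    fun n hn => by simp [hn]
  simpa [besselCoeff_zero hν] using h

theorem tanhDiv_eq_normBesselI_div :
    tanhDiv = fun x => normBesselI (-1 / 2 + 1) x / normBesselI (-1 / 2) x := by
  funext x
  unfold tanhDiv
  split_ifs with hx
  · rw [hx, normBesselI_zero (by norm_num), normBesselI_zero (by norm_num), div_one]
  · rw [tanh_eq_sinh_div_cosh, normBesselI_neg_half, ← mul_normBesselI_half x]
    field_simp

theorem sharpExponents_tanhDiv {r : ℝ} (hr : 0 < r) : SharpExponents r tanhDiv (r ^ 2 / 3) 0 := by
  rw [tanhDiv_eq_normBesselI_div]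
  convert sharpExponents_normBesselI_div (show -1 < (-1 / 2 : ℝ) by norm_num) hr using 1
  norm_num

theorem theorem5 :
    (∀ ν r : ℝ, -1 < ν → 0 < r →
      SharpExponents r (fun x => normBesselI (ν + 1) x / normBesselI ν x)
        (r ^ 2 / (4 * (ν + 1) * (ν + 2))) 0) ∧
    (∀ r : ℝ, 0 < r → SharpExponents r tanhDiv (r ^ 2 / 3) 0) ∧
    SharpExponents (Real.pi / 2) tanhDiv (Real.pi ^ 2 / 12) 0 := by
  refine ⟨fun ν r hν hr => sharpExponents_normBesselI_div hν hr,
    fun r hr => sharpExponents_tanhDiv hr, ?_⟩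
  convert sharpExponents_tanhDiv (show 0 < Real.pi / 2 by positivity) using 1
  ring
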